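/- **Theorem 1.1.** There is a smooth arc-length parametrized curve $\alpha:(0,\infty)\to\mathbb{R}^3$ with curvature and torsion $$\kappa(s)=\|\alpha''(s)\|=\frac{\sqrt5}{s},\qquad \tau(s)=\frac{\det(\alpha',\alpha'',\alpha''')}{\kappa(s)^2}=\frac{3\sqrt7}{2s},$$ and any two such curves differ by an orientation-preserving isometry of $\mathbb{R}^3$. Let $\alpha$ be such a curve, let $N=\alpha''/\kappa$ be its principal normal, and let $S$ be the ruled surface parametrized by $$x(s,t)=\alpha(s)+t\,N(s),\qquad s>0,\ t\in\mathbb{R}.$$ Then $x$ is a smooth immersion, so that $S$, with the metric induced from $\mathbb{R}^3$, is an immersed Riemannian surface, and for every integer $n>1$ there is a triharmonic curve with nonconstant curvature in the Riemannian product $S\times\mathbb{R}^{n-2}$, namely the curve $s\mapsto(\alpha(s),0)$, $s>0$ (in the parameters of $S$, the point $\alpha(s)$ is $(s,0)$). Here a smooth arc-length parametrized curve $\gamma:I\to M$ from an open interval $I$ to a Riemannian manifold $M$, with unit tangent $T=\gamma'$, is called triharmonic if $$\nabla_T^5T+R(\nabla_T^3T,T)\,T-R(\nabla_T^2T,\nabla_TT)\,T=0,$$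 where $\nabla$ is the Levi-Civita connection and $R(X,Y)Z=\nabla_X\nabla_YZ-\nabla_Y\nabla_XZ-\nabla_{[X,Y]}Z$; its curvature is the function $\|\nabla_TT\|$. -/

import Mathlib

open scoped ContDiff

noncomputable section

namespace TriharmonicCurves

/-! Riemannian geometry in a coordinate domain `U ⊆ ℝ^ι`. -/

section Riemannian

variable {ι : Type*} [Fintype ι] [DecidableEq ι]

/-- The partial derivative `∂f/∂pⁱ` at `p`. -/
def partialDeriv {F : Type*} [NormedAddCommGroup F] [NormedSpace ℝ F]
    (i : ι) (f : (ι → ℝ) → F) (p : ι → ℝ) : F :=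
  fderiv ℝ f p (Pi.single i 1)

/-- `g = (g_ij)` is a smooth Riemannian metric on the open set `U`. -/
structure IsRiemannianMetric (U : Set (ι → ℝ)) (g : (ι → ℝ) → Matrix ι ι ℝ) : Prop where
  isOpen : IsOpen U
  smooth : ∀ i j, ContDiffOn ℝ ∞ (fun p => g p i j) U
  posDef : ∀ p ∈ U, (g p).PosDef

/-- The Christoffel symbol `Γ^k_ij = ½ ∑_l g^{kl} (∂_i g_jl + ∂_j g_il - ∂_l g_ij)` of the
Levi-Civita connection. -/
def christoffel (g : (ι → ℝ) → Matrix ι ι ℝ) (k i j : ι) (p : ι → ℝ) : ℝ :=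
  (1 / 2) * ∑ l, (g p)⁻¹ k l *
    (partialDeriv i (fun q => g q j l) p + partialDeriv j (fun q => g q i l) p
      - partialDeriv l (fun q => g q i j) p)

/-- The Riemannian curvature tensor
`R(X,Y)Z = ∇_X ∇_Y Z - ∇_Y ∇_X Z - ∇_[X,Y] Z` at the point `p`. -/
def curvatureTensor (g : (ι → ℝ) → Matrix ι ι ℝ) (p : ι → ℝ) (X Y Z : ι → ℝ) : ι → ℝ :=
  fun l => ∑ i, ∑ j, ∑ k,
    (partialDeriv i (christoffel g l j k) p - partialDeriv j (christoffel g l i k) p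
      + ∑ m, (christoffel g l i m p * christoffel g m j k p
          - christoffel g l j m p * christoffel g m i k p)) * X i * Y j * Z k

/-- The covariant derivative `∇_{γ'} V` of a vector field `V` along the curve `γ`. -/
def covDeriv (g : (ι → ℝ) → Matrix ι ι ℝ) (γ : ℝ → ι → ℝ) (V : ℝ → ι → ℝ) : ℝ → ι → ℝ :=
  fun s k => deriv V s k + ∑ i, ∑ j, christoffel g k i j (γ s) * deriv γ s i * V s j

/-- The length of the tangent vector `v` at `p`. -/
def metricNorm (g : (ι → ℝ) → Matrix ι ι ℝ) (p v : ι → ℝ) : ℝ :=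
  Real.sqrt (∑ i, ∑ j, g p i j * v i * v j)

/-- The field `∇_T^m T` along `γ`, where `T = γ'`. -/
def covDerivTangent (g : (ι → ℝ) → Matrix ι ι ℝ) (γ : ℝ → ι → ℝ) (m : ℕ) : ℝ → ι → ℝ :=
  (covDeriv g γ)^[m] (deriv γ)

/-- The curvature `‖∇_T T‖` of an arc-length parametrized curve in a Riemannian manifold. -/
def curveCurvature (g : (ι → ℝ) → Matrix ι ι ℝ) (γ : ℝ → ι → ℝ) (s : ℝ) : ℝ :=
  metricNorm g (γ s) (covDerivTangent g γ 1 s)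

/-- `γ : I → U` is a smooth arc-length parametrized curve on the open interval `I` with
`∇_T⁵ T + R(∇_T³ T, T) T - R(∇_T² T, ∇_T T) T = 0`. -/
structure IsTriharmonicCurve (U : Set (ι → ℝ)) (g : (ι → ℝ) → Matrix ι ι ℝ)
    (I : Set ℝ) (γ : ℝ → ι → ℝ) : Prop where
  isOpen : IsOpen I
  interval : I.OrdConnected
  smooth : ContDiffOn ℝ ∞ γ I
  mapsTo : Set.MapsTo γ I U
  unitSpeed : ∀ s ∈ I, metricNorm g (γ s) (deriv γ s) = 1
  equation : ∀ s ∈ I,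
    covDerivTangent g γ 5 s
      + curvatureTensor g (γ s) (covDerivTangent g γ 3 s) (deriv γ s) (deriv γ s)
      - curvatureTensor g (γ s) (covDerivTangent g γ 2 s) (covDerivTangent g γ 1 s)
          (deriv γ s) = 0

end Riemannian

/-! Curves and surfaces in Euclidean 3-space. -/

/-- Euclidean 3-space. -/
abbrev E3 : Type := EuclideanSpace ℝ (Fin 3)

/-- The curvature `‖α''‖` of an arc-length parametrized space curve. -/
def spaceCurvature (α : ℝ → E3) (s : ℝ) : ℝ := ‖iteratedDeriv 2 α s‖

/-- The torsion `det(α', α'', α''') / κ²` of an arc-length parametrized space curve. -/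
def spaceTorsion (α : ℝ → E3) (s : ℝ) : ℝ :=
  (Matrix.of ![⇑(deriv α s), ⇑(iteratedDeriv 2 α s), ⇑(iteratedDeriv 3 α s)]).det
    / spaceCurvature α s ^ 2

/-- The principal normal `α'' / κ` of an arc-length parametrized space curve. -/
def principalNormal (α : ℝ → E3) (s : ℝ) : E3 := (spaceCurvature α s)⁻¹ • iteratedDeriv 2 α s

/-- `α : (0,∞) → ℝ³` is a smooth arc-length parametrized curve with curvature `√5 / s` and
torsion `3√7 / (2s)`. -/
structure IsGeneratingCurve (α : ℝ → E3) : Prop where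
  smooth : ContDiffOn ℝ ∞ α (Set.Ioi 0)
  unitSpeed : ∀ s, 0 < s → ‖deriv α s‖ = 1
  curvature : ∀ s, 0 < s → spaceCurvature α s = Real.sqrt 5 / s
  torsion : ∀ s, 0 < s → spaceTorsion α s = 3 * Real.sqrt 7 / (2 * s)

/-- `β` is the image of `α` under a rigid motion (an orientation-preserving isometry of `ℝ³`),
as curves on `(0,∞)`. -/
def RigidlyCongruent (α β : ℝ → E3) : Prop :=
  ∃ Φ : E3 ≃ᵃⁱ[ℝ] E3,
    0 < LinearMap.det (Φ.linearIsometryEquiv.toLinearEquiv : E3 →ₗ[ℝ] E3) ∧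
      ∀ s, 0 < s → β s = Φ (α s)

/-- The ruled surface `x(s,t) = α(s) + t N(s)`, with `s = p 0` and `t = p 1`. -/
def ruledSurface (α : ℝ → E3) (p : Fin 2 → ℝ) : E3 := α (p 0) + p 1 • principalNormal α (p 0)

/-- The parameter domain `s > 0`, `t ∈ ℝ` of the ruled surface. -/
def surfaceDomain : Set (Fin 2 → ℝ) := {p | 0 < p 0}

/-- `x : W → ℝ³` is a smooth immersion of the open set `W ⊆ ℝ²`. -/
structure IsImmersedSurface (W : Set (Fin 2 → ℝ)) (x : (Fin 2 → ℝ) → E3) : Prop where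
  isOpen : IsOpen W
  smooth : ContDiffOn ℝ ∞ x W
  injective : ∀ p ∈ W, Function.Injective (fderiv ℝ x p)

/-- The metric induced on a parametrized surface by the inner product of `ℝ³`:
`g_ij = ⟨∂_i x, ∂_j x⟩`. -/
def inducedMetric (x : (Fin 2 → ℝ) → E3) (p : Fin 2 → ℝ) : Matrix (Fin 2) (Fin 2) ℝ :=
  Matrix.of fun i j => inner ℝ (partialDeriv i x p) (partialDeriv j x p)

/-- The coordinate domain `W × ℝ^m` of the product of a surface with `ℝ^m`. -/
def productDomain (W : Set (Fin 2 → ℝ)) (m : ℕ) : Set (Fin 2 ⊕ Fin m → ℝ) :=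
  {p | p ∘ Sum.inl ∈ W}

/-- The product of a surface metric `h` with the standard metric of `ℝ^m`. -/
def productMetric (h : (Fin 2 → ℝ) → Matrix (Fin 2) (Fin 2) ℝ) (m : ℕ)
    (p : Fin 2 ⊕ Fin m → ℝ) : Matrix (Fin 2 ⊕ Fin m) (Fin 2 ⊕ Fin m) ℝ :=
  Matrix.fromBlocks (h (p ∘ Sum.inl)) 0 0 1

/-- The curve `s ↦ (α(s), 0)` of `S × ℝ^m` in the coordinates `(s, t, y)`, that is,
`t = 0` and `y = 0`. -/
def baseCurve (m : ℕ) (s : ℝ) : Fin 2 ⊕ Fin m → ℝ := Sum.elim ![s, 0] 0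

end TriharmonicCurves

end

/-!
The curvature `√5 / s` and the torsion `3√7 / (2s)` have a constant ratio, and a curve with
curvature `k / s` and torsion `b / s` has constant coefficients in its Frenet system once `log s` is
the parameter. This gives an explicit solution, `conicalHelix`. Two solutions are congruent
(`rigidlyCongruent_of_eq_curvature_torsion`): the Frenet system is skew-symmetric, so the orthogonal
matrix carrying one Frenet frame to the other is constant.

By the Frenet equations the surface of principal normals has the metric
`((1 - tκ)² + (tτ)²) ds² + dt²` (`inducedMetric_ruledSurface`), nondegenerate because `τ ≠ 0`.
On the base curve `t = 0` one has `∇_T T = κ N` and `∇_T N = -κ T` (`covDeriv_baseCurve`), and the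
Gauss curvature is `-τ²` (`curvatureTensor_baseCurve`). For `κ = k / s` every `∇_Tⁿ T` is therefore
a constant combination of `T` and `N`, up to a power of `s`. The tangential part of the triharmonic
equation reads `10 k² (5 - k²) = 0`, so `k² = 5`, and with this the normal part reads `8 b² = 126`,
that is `b² = 63 / 4`. The flat factor contributes nothing.

Partial derivatives are computed as one-variable derivatives
(`partialDeriv_eq_of_hasDerivAt_update`). This keeps the differentiation of the Christoffel symbols
in `s` short, since on the base curve each of them is a constant multiple of `1 / s`.
-/

open scoped ContDiff

noncomputable section

namespace TriharmonicCurves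

/-! ### Oriented orthonormal frames in Euclidean 3-space -/

/-- The vector product on `E3`, Mathlib's coordinate cross product read in `EuclideanSpace`. -/
def crossE3 (v w : E3) : E3 := WithLp.toLp 2 (crossProduct v.ofLp w.ofLp)

lemma crossE3_zero (v w : E3) : crossE3 v w 0 = v 1 * w 2 - v 2 * w 1 := by
  simp [crossE3, cross_apply]

lemma crossE3_one (v w : E3) : crossE3 v w 1 = v 2 * w 0 - v 0 * w 2 := by
  simp [crossE3, cross_apply]

lemma crossE3_two (v w : E3) : crossE3 v w 2 = v 0 * w 1 - v 1 * w 0 := by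
  simp [crossE3, cross_apply]

lemma inner_E3 (v w : E3) : inner ℝ v w = v 0 * w 0 + v 1 * w 1 + v 2 * w 2 := by
  simp only [PiLp.inner_apply, Fin.sum_univ_three, RCLike.inner_apply, conj_trivial]
  ring

lemma hasDerivAt_E3_iff {f : ℝ → E3} {f' : E3} {s : ℝ} :
    HasDerivAt f f' s ↔ ∀ i, HasDerivAt (fun u => f u i) (f' i) s := by
  rw [← hasDerivAt_pi]
  exact ⟨fun h => (PiLp.continuousLinearEquiv 2 ℝ
      fun _ : Fin 3 => ℝ).toContinuousLinearMap.hasFDerivAt.comp_hasDerivAt s h,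
    fun h => (PiLp.continuousLinearEquiv 2 ℝ
      fun _ : Fin 3 => ℝ).symm.toContinuousLinearMap.hasFDerivAt.comp_hasDerivAt s h⟩

lemma hasDerivAt_crossE3 {f g : ℝ → E3} {f' g' : E3} {s : ℝ} (hf : HasDerivAt f f' s)
    (hg : HasDerivAt g g' s) :
    HasDerivAt (fun u => crossE3 (f u) (g u)) (crossE3 (f s) g' + crossE3 f' (g s)) s := by
  rw [hasDerivAt_E3_iff] at hf hg ⊢
  intro i
  fin_cases i
  · simp only [Fin.zero_eta, PiLp.add_apply, crossE3_zero]
    refine (((hf 1).mul (hg 2)).sub ((hf 2).mul (hg 1))).congr_deriv ?_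
    ring
  · simp only [Fin.mk_one, PiLp.add_apply, crossE3_one]
    refine (((hf 2).mul (hg 0)).sub ((hf 0).mul (hg 2))).congr_deriv ?_
    ring
  · simp only [Fin.reduceFinMk, PiLp.add_apply, crossE3_two]
    refine (((hf 0).mul (hg 1)).sub ((hf 1).mul (hg 0))).congr_deriv ?_
    ring

/-- The matrix with rows `t`, `n`, `t × n`. -/
def frameMatrix (t n : E3) : Matrix (Fin 3) (Fin 3) ℝ :=
  Matrix.of ![t.ofLp, n.ofLp, (crossE3 t n).ofLp]

section Orthonormal

variable {t n : E3}

lemma norm_eq_one_iff_E3 {v : E3} : ‖v‖ = 1 ↔ v 0 * v 0 + v 1 * v 1 + v 2 * v 2 = 1 := by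
  rw [← inner_E3, real_inner_self_eq_norm_sq]
  constructor
  · intro h
    simp [h]
  · intro h
    nlinarith [norm_nonneg v]

lemma inner_crossE3_left : inner ℝ t (crossE3 t n) = (0 : ℝ) := by
  rw [inner_E3, crossE3_zero, crossE3_one, crossE3_two]
  ring

lemma inner_crossE3_right : inner ℝ n (crossE3 t n) = (0 : ℝ) := by
  rw [inner_E3, crossE3_zero, crossE3_one, crossE3_two]
  ring

lemma inner_crossE3_self (ht : ‖t‖ = 1) (hn : ‖n‖ = 1) (h : inner ℝ t n = (0 : ℝ)) :
    inner ℝ (crossE3 t n) (crossE3 t n) = (1 : ℝ) := by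
  rw [norm_eq_one_iff_E3] at ht hn
  rw [inner_E3] at h ⊢
  rw [crossE3_zero, crossE3_one, crossE3_two]
  -- Lagrange's identity `|t × n|² = |t|² |n|² - ⟨t, n⟩²`
  linear_combination (n 0 * n 0 + n 1 * n 1 + n 2 * n 2) * ht + hn
    - (t 0 * n 0 + t 1 * n 1 + t 2 * n 2) * h

lemma frameMatrix_mul_transpose (ht : ‖t‖ = 1) (hn : ‖n‖ = 1) (h : inner ℝ t n = (0 : ℝ)) :
    frameMatrix t n * (frameMatrix t n).transpose = 1 := by
  have h3 := inner_crossE3_self ht hn h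
  have h4 := inner_crossE3_left (t := t) (n := n)
  have h5 := inner_crossE3_right (t := t) (n := n)
  rw [norm_eq_one_iff_E3] at ht hn
  rw [inner_E3] at h h3 h4 h5
  ext i j
  fin_cases i <;> fin_cases j <;>
    simp [frameMatrix, Matrix.mul_apply, Fin.sum_univ_three] <;> linarith

lemma transpose_mul_frameMatrix (ht : ‖t‖ = 1) (hn : ‖n‖ = 1) (h : inner ℝ t n = (0 : ℝ)) :
    (frameMatrix t n).transpose * frameMatrix t n = 1 :=
  mul_eq_one_comm.mp (frameMatrix_mul_transpose ht hn h)

lemma det_frameMatrix (ht : ‖t‖ = 1) (hn : ‖n‖ = 1) (h : inner ℝ t n = (0 : ℝ)) :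
    (frameMatrix t n).det = 1 := by
  have h3 := inner_crossE3_self ht hn h
  rw [inner_E3, crossE3_zero, crossE3_one, crossE3_two] at h3
  rw [Matrix.det_fin_three]
  simp [frameMatrix, crossE3_zero, crossE3_one, crossE3_two]
  linear_combination h3

/-- Expansion of a vector in the orthonormal basis `t`, `n`, `t × n`. -/
lemma eq_sum_inner_smul_frame (ht : ‖t‖ = 1) (hn : ‖n‖ = 1) (h : inner ℝ t n = (0 : ℝ)) (v : E3) :
    v = (inner ℝ t v : ℝ) • t + (inner ℝ n v : ℝ) • n
      + (inner ℝ (crossE3 t n) v : ℝ) • crossE3 t n := by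
  have key := transpose_mul_frameMatrix ht hn h
  have hv : (frameMatrix t n).transpose.mulVec ((frameMatrix t n).mulVec v.ofLp) = v.ofLp := by
    rw [Matrix.mulVec_mulVec, key, Matrix.one_mulVec]
  ext i
  have hi := congrFun hv i
  rw [← hi]
  simp [frameMatrix, Matrix.mulVec, dotProduct, Fin.sum_univ_three, inner_E3]
  ring

lemma crossE3_crossE3 (ht : ‖t‖ = 1) (h : inner ℝ t n = (0 : ℝ)) :
    crossE3 t (crossE3 t n) = -n := by
  rw [norm_eq_one_iff_E3] at ht
  rw [inner_E3] at h
  ext i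
  fin_cases i
  · simp [crossE3_zero, crossE3_one, crossE3_two]
    linear_combination (t 0) * h - n 0 * ht
  · simp [crossE3_zero, crossE3_one, crossE3_two]
    linear_combination (t 1) * h - n 1 * ht
  · simp [crossE3_zero, crossE3_one, crossE3_two]
    linear_combination (t 2) * h - n 2 * ht

end Orthonormal

/-! ### The Frenet equations -/

/-- The binormal `T × N` of a space curve. -/
def binormal (α : ℝ → E3) (s : ℝ) : E3 := crossE3 (deriv α s) (principalNormal α s)

section Frenet

variable {α : ℝ → E3} {U : Set ℝ} {s : ℝ}

lemma iteratedDeriv_two_eq (α : ℝ → E3) : iteratedDeriv 2 α = deriv (deriv α) := by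
  rw [iteratedDeriv_succ, iteratedDeriv_one]

lemma contDiffOn_deriv (hU : IsOpen U) (hα : ContDiffOn ℝ ∞ α U) :
    ContDiffOn ℝ ∞ (deriv α) U :=
  ((contDiffOn_infty_iff_deriv_of_isOpen hU).mp hα).2

lemma hasDerivAt_of_contDiffOn (hU : IsOpen U) (hα : ContDiffOn ℝ ∞ α U) (hs : s ∈ U) :
    HasDerivAt α (deriv α s) s :=
  ((hα.contDiffAt (hU.mem_nhds hs)).differentiableAt (by simp)).hasDerivAt

lemma contDiffOn_principalNormal (hU : IsOpen U) (hα : ContDiffOn ℝ ∞ α U)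
    (hκ : ∀ s ∈ U, spaceCurvature α s ≠ 0) : ContDiffOn ℝ ∞ (principalNormal α) U := by
  have h2 : ContDiffOn ℝ ∞ (iteratedDeriv 2 α) U := by
    rw [iteratedDeriv_two_eq]
    exact contDiffOn_deriv hU (contDiffOn_deriv hU hα)
  have hk : ContDiffOn ℝ ∞ (spaceCurvature α) U :=
    h2.norm ℝ fun s hs => norm_ne_zero_iff.mp (hκ s hs)
  exact (hk.inv hκ).smul h2

lemma iteratedDeriv_two_eq_smul (hκ : spaceCurvature α s ≠ 0) :
    iteratedDeriv 2 α s = spaceCurvature α s • principalNormal α s := by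
  rw [principalNormal, smul_inv_smul₀ hκ]

lemma norm_principalNormal (hκ : spaceCurvature α s ≠ 0) : ‖principalNormal α s‖ = 1 := by
  rw [principalNormal, norm_smul, norm_inv, spaceCurvature, norm_norm]
  exact inv_mul_cancel₀ hκ

lemma inner_deriv_eq_zero_of_inner_const {f g : ℝ → E3} {f' g' : E3} {c : ℝ} (hU : IsOpen U)
    (hs : s ∈ U) (hf : HasDerivAt f f' s) (hg : HasDerivAt g g' s)
    (h : ∀ u ∈ U, (inner ℝ (f u) (g u) : ℝ) = c) :
    (inner ℝ (f s) g' : ℝ) + inner ℝ f' (g s) = 0 := by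
  have h1 := hf.inner ℝ hg
  have h2 : HasDerivAt (fun u => (inner ℝ (f u) (g u) : ℝ)) 0 s :=
    (hasDerivAt_const s c).congr_of_eventuallyEq
      (Filter.eventually_of_mem (hU.mem_nhds hs) h)
  exact h1.unique h2

lemma inner_deriv_principalNormal (hU : IsOpen U) (hα : ContDiffOn ℝ ∞ α U)
    (h1 : ∀ s ∈ U, ‖deriv α s‖ = 1) (hs : s ∈ U) :
    inner ℝ (deriv α s) (principalNormal α s) = (0 : ℝ) := by
  have hT := hasDerivAt_of_contDiffOn hU (contDiffOn_deriv hU hα) hs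
  have h := inner_deriv_eq_zero_of_inner_const (c := 1) hU hs hT hT fun u hu => by
    rw [real_inner_self_eq_norm_sq, h1 u hu, one_pow]
  rw [real_inner_comm, ← two_mul] at h
  rw [principalNormal, inner_smul_right, iteratedDeriv_two_eq, real_inner_comm]
  rw [(mul_eq_zero.mp h).resolve_left two_ne_zero, mul_zero]

/-- First Frenet equation `T' = κ N`. -/
lemma hasDerivAt_tangent (hU : IsOpen U) (hα : ContDiffOn ℝ ∞ α U)
    (hκ : ∀ s ∈ U, spaceCurvature α s ≠ 0) (hs : s ∈ U) :
    HasDerivAt (deriv α) (spaceCurvature α s • principalNormal α s) s := by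
  rw [← iteratedDeriv_two_eq_smul (hκ s hs), iteratedDeriv_two_eq]
  exact hasDerivAt_of_contDiffOn hU (contDiffOn_deriv hU hα) hs

lemma spaceTorsion_eq_inner (hU : IsOpen U) (hα : ContDiffOn ℝ ∞ α U)
    (hκ : ∀ s ∈ U, spaceCurvature α s ≠ 0) (hs : s ∈ U) :
    spaceTorsion α s = inner ℝ (binormal α s) (deriv (principalNormal α) s) := by
  have hN := hasDerivAt_of_contDiffOn hU (contDiffOn_principalNormal hU hα hκ) hs
  have hk : DifferentiableAt ℝ (spaceCurvature α) s := by
    have h2 : ContDiffOn ℝ ∞ (iteratedDeriv 2 α) U := by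
      rw [iteratedDeriv_two_eq]
      exact contDiffOn_deriv hU (contDiffOn_deriv hU hα)
    have h3 : ContDiffOn ℝ ∞ (spaceCurvature α) U :=
      h2.norm ℝ fun s hs => norm_ne_zero_iff.mp (hκ s hs)
    exact (h3.contDiffAt (hU.mem_nhds hs)).differentiableAt (by simp)
  have h3 : iteratedDeriv 3 α s = spaceCurvature α s • deriv (principalNormal α) s
      + deriv (spaceCurvature α) s • principalNormal α s := by
    rw [iteratedDeriv_succ]
    refine HasDerivAt.deriv ?_
    refine (hk.hasDerivAt.smul hN).congr_of_eventuallyEq ?_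
    exact Filter.eventually_of_mem (hU.mem_nhds hs) fun u hu => iteratedDeriv_two_eq_smul (hκ u hu)
  have hk0 := hκ s hs
  rw [spaceTorsion, h3, iteratedDeriv_two_eq_smul hk0, div_eq_iff (pow_ne_zero 2 hk0),
    Matrix.det_fin_three, inner_E3, binormal, crossE3_zero, crossE3_one, crossE3_two]
  simp
  ring

/-- Second Frenet equation `N' = -κ T + τ B`. -/
lemma hasDerivAt_principalNormal (hU : IsOpen U) (hα : ContDiffOn ℝ ∞ α U)
    (h1 : ∀ s ∈ U, ‖deriv α s‖ = 1) (hκ : ∀ s ∈ U, spaceCurvature α s ≠ 0) (hs : s ∈ U) :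
    HasDerivAt (principalNormal α)
      (-spaceCurvature α s • deriv α s + spaceTorsion α s • binormal α s) s := by
  have hT := hasDerivAt_tangent hU hα hκ hs
  have hN := hasDerivAt_of_contDiffOn hU (contDiffOn_principalNormal hU hα hκ) hs
  have hn := norm_principalNormal (hκ s hs)
  have hNN : (inner ℝ (principalNormal α s) (deriv (principalNormal α) s) : ℝ) = 0 := by
    have h := inner_deriv_eq_zero_of_inner_const (c := 1) hU hs hN hN fun u hu => by
      rw [real_inner_self_eq_norm_sq, norm_principalNormal (hκ u hu), one_pow]
    rw [real_inner_comm, ← two_mul] at h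
    rw [real_inner_comm]
    exact (mul_eq_zero.mp h).resolve_left two_ne_zero
  have hTN : (inner ℝ (deriv α s) (deriv (principalNormal α) s) : ℝ) = -spaceCurvature α s := by
    have h := inner_deriv_eq_zero_of_inner_const (c := 0) hU hs hT hN fun u hu =>
      inner_deriv_principalNormal hU hα h1 hu
    rw [inner_smul_left, real_inner_self_eq_norm_sq, hn] at h
    simp at h
    linarith
  have e := eq_sum_inner_smul_frame (h1 s hs) hn (inner_deriv_principalNormal hU hα h1 hs)
    (deriv (principalNormal α) s)
  rw [hNN, hTN, ← binormal, ← spaceTorsion_eq_inner hU hα hκ hs, zero_smul, add_zero] at e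
  rw [← e]
  exact hN

/-- Third Frenet equation `B' = -τ N`. -/
lemma hasDerivAt_binormal (hU : IsOpen U) (hα : ContDiffOn ℝ ∞ α U)
    (h1 : ∀ s ∈ U, ‖deriv α s‖ = 1) (hκ : ∀ s ∈ U, spaceCurvature α s ≠ 0) (hs : s ∈ U) :
    HasDerivAt (binormal α) (-spaceTorsion α s • principalNormal α s) s := by
  have h := hasDerivAt_crossE3 (hasDerivAt_tangent hU hα hκ hs)
    (hasDerivAt_principalNormal hU hα h1 hκ hs)
  have hb := crossE3_crossE3 (h1 s hs) (inner_deriv_principalNormal hU hα h1 hs)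
  rw [← binormal] at hb
  refine h.congr_deriv (Eq.symm ?_)
  have : ∀ a b : ℝ, ∀ t n c : E3, crossE3 t (a • t + b • c) + crossE3 (-a • n) n
      = b • crossE3 t c := by
    intro a b t n c
    ext i
    fin_cases i <;> simp [crossE3_zero, crossE3_one, crossE3_two] <;> ring
  have h' := this (-spaceCurvature α s) (spaceTorsion α s) (deriv α s) (principalNormal α s)
    (binormal α s)
  rw [neg_neg] at h'
  rw [h', hb, smul_neg, neg_smul]

end Frenet

/-! ### Uniqueness up to rigid motions -/

/-- The coefficients `∑ F_k(β)_i F_k(α)_j` of the map carrying the Frenet frame of `α` to that of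
`β` are constant when the curvatures and torsions agree, as the Frenet system is skew-symmetric. -/
lemma hasDerivAt_frameMatrix_transpose_mul {α β : ℝ → E3} {U : Set ℝ} {s : ℝ} (hU : IsOpen U)
    (hα : ContDiffOn ℝ ∞ α U) (hβ : ContDiffOn ℝ ∞ β U)
    (hα1 : ∀ s ∈ U, ‖deriv α s‖ = 1) (hβ1 : ∀ s ∈ U, ‖deriv β s‖ = 1)
    (hακ : ∀ s ∈ U, spaceCurvature α s ≠ 0)
    (hκ : ∀ s ∈ U, spaceCurvature β s = spaceCurvature α s)
    (hτ : ∀ s ∈ U, spaceTorsion β s = spaceTorsion α s) (hs : s ∈ U) (i j : Fin 3) :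
    HasDerivAt (fun u => ((frameMatrix (deriv β u) (principalNormal β u)).transpose
      * frameMatrix (deriv α u) (principalNormal α u)) i j) 0 s := by
  have hβκ : ∀ s ∈ U, spaceCurvature β s ≠ 0 := fun u hu => by rw [hκ u hu]; exact hακ u hu
  have hT := hasDerivAt_E3_iff.mp (hasDerivAt_tangent hU hα hακ hs) j
  have hN := hasDerivAt_E3_iff.mp (hasDerivAt_principalNormal hU hα hα1 hακ hs) j
  have hB := hasDerivAt_E3_iff.mp (hasDerivAt_binormal hU hα hα1 hακ hs) j
  have hT' := hasDerivAt_E3_iff.mp (hasDerivAt_tangent hU hβ hβκ hs) i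
  have hN' := hasDerivAt_E3_iff.mp (hasDerivAt_principalNormal hU hβ hβ1 hβκ hs) i
  have hB' := hasDerivAt_E3_iff.mp (hasDerivAt_binormal hU hβ hβ1 hβκ hs) i
  have hfun : (fun u => ((frameMatrix (deriv β u) (principalNormal β u)).transpose
      * frameMatrix (deriv α u) (principalNormal α u)) i j)
      = fun u => deriv β u i * deriv α u j + principalNormal β u i * principalNormal α u j
        + binormal β u i * binormal α u j := by
    funext u
    simp [frameMatrix, Matrix.mul_apply, Fin.sum_univ_three, binormal]
  rw [hfun]
  refine (((hT'.mul hT).add (hN'.mul hN)).add (hB'.mul hB)).congr_deriv ?_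
  rw [hκ s hs, hτ s hs]
  simp only [PiLp.add_apply, PiLp.smul_apply, smul_eq_mul]
  ring

/-- The linear isometry of `E3` given by an orthogonal matrix. -/
def orthogonalIsometry (Q : Matrix (Fin 3) (Fin 3) ℝ) (hQ : Q.transpose * Q = 1) : E3 ≃ₗᵢ[ℝ] E3 :=
  LinearIsometry.toLinearIsometryEquiv
    (LinearMap.isometryOfInner (Matrix.toEuclideanLin Q) fun x y => by
      rw [EuclideanSpace.inner_eq_star_dotProduct, EuclideanSpace.inner_eq_star_dotProduct,
        Matrix.ofLp_toLpLin, Matrix.ofLp_toLpLin, Matrix.toLin'_apply,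
        Matrix.toLin'_apply, star_trivial, star_trivial, Matrix.dotProduct_mulVec,
        Matrix.vecMul_mulVec, hQ, Matrix.vecMul_one])
    rfl

lemma orthogonalIsometry_apply (Q : Matrix (Fin 3) (Fin 3) ℝ) (hQ : Q.transpose * Q = 1) (x : E3) :
    orthogonalIsometry Q hQ x = WithLp.toLp 2 (Q.mulVec x.ofLp) := rfl

lemma det_orthogonalIsometry (Q : Matrix (Fin 3) (Fin 3) ℝ) (hQ : Q.transpose * Q = 1) :
    LinearMap.det ((orthogonalIsometry Q hQ).toLinearEquiv : E3 →ₗ[ℝ] E3) = Q.det := by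
  have h : ((orthogonalIsometry Q hQ).toLinearEquiv : E3 →ₗ[ℝ] E3) = Matrix.toEuclideanLin Q := by
    ext x : 1
    rfl
  rw [h, Matrix.toEuclideanLin, Matrix.toLpLin_eq_toLin, LinearMap.det_toLin]

/-- Fundamental theorem of space curves, uniqueness part. -/
lemma rigidlyCongruent_of_eq_curvature_torsion {α β : ℝ → E3}
    (hα : ContDiffOn ℝ ∞ α (Set.Ioi 0)) (hβ : ContDiffOn ℝ ∞ β (Set.Ioi 0))
    (hα1 : ∀ s ∈ Set.Ioi (0 : ℝ), ‖deriv α s‖ = 1) (hβ1 : ∀ s ∈ Set.Ioi (0 : ℝ), ‖deriv β s‖ = 1)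
    (hακ : ∀ s ∈ Set.Ioi (0 : ℝ), spaceCurvature α s ≠ 0)
    (hκ : ∀ s ∈ Set.Ioi (0 : ℝ), spaceCurvature β s = spaceCurvature α s)
    (hτ : ∀ s ∈ Set.Ioi (0 : ℝ), spaceTorsion β s = spaceTorsion α s) :
    RigidlyCongruent α β := by
  have hU : IsOpen (Set.Ioi (0 : ℝ)) := isOpen_Ioi
  have hβκ : ∀ s ∈ Set.Ioi (0 : ℝ), spaceCurvature β s ≠ 0 := fun u hu => by
    rw [hκ u hu]; exact hακ u hu
  have h1 : (1 : ℝ) ∈ Set.Ioi (0 : ℝ) := Set.mem_Ioi.mpr one_pos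
  set F : (ℝ → E3) → ℝ → Matrix (Fin 3) (Fin 3) ℝ :=
    fun γ u => frameMatrix (deriv γ u) (principalNormal γ u) with hF
  have hdet : ∀ γ : ℝ → E3, ContDiffOn ℝ ∞ γ (Set.Ioi 0) →
      (∀ s ∈ Set.Ioi (0 : ℝ), ‖deriv γ s‖ = 1) →
      (∀ s ∈ Set.Ioi (0 : ℝ), spaceCurvature γ s ≠ 0) → ∀ s ∈ Set.Ioi (0 : ℝ),
      (F γ s).det = 1 ∧ (F γ s).transpose * F γ s = 1 ∧ F γ s * (F γ s).transpose = 1 := by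
    intro γ hγ hγ1 hγκ s hs
    have h := inner_deriv_principalNormal hU hγ hγ1 hs
    have hn := norm_principalNormal (hγκ s hs)
    exact ⟨det_frameMatrix (hγ1 s hs) hn h, transpose_mul_frameMatrix (hγ1 s hs) hn h,
      frameMatrix_mul_transpose (hγ1 s hs) hn h⟩
  set Q : Matrix (Fin 3) (Fin 3) ℝ := (F β 1).transpose * F α 1 with hQdef
  obtain ⟨da, ta, ma⟩ := hdet α hα hα1 hακ 1 h1
  obtain ⟨db, tb, mb⟩ := hdet β hβ hβ1 hβκ 1 h1
  have hconst : ∀ s ∈ Set.Ioi (0 : ℝ), (F β s).transpose * F α s = Q := by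
    intro s hs
    ext i j
    have hd := fun u (hu : u ∈ Set.Ioi (0 : ℝ)) =>
      hasDerivAt_frameMatrix_transpose_mul hU hα hβ hα1 hβ1 hακ hκ hτ hu i j
    exact hU.is_const_of_deriv_eq_zero isPreconnected_Ioi
      (fun u hu => (hd u hu).differentiableAt.differentiableWithinAt)
      (fun u hu => (hd u hu).deriv) hs h1
  have hQ : Q.transpose * Q = 1 := by
    rw [hQdef, Matrix.transpose_mul, Matrix.transpose_transpose, Matrix.mul_assoc,
      ← Matrix.mul_assoc (F β 1), mb, Matrix.one_mul, ta]
  have hQd : Q.det = 1 := by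
    rw [hQdef, Matrix.det_mul, Matrix.det_transpose, da, db, one_mul]
  set L := orthogonalIsometry Q hQ with hL
  have htan : ∀ s ∈ Set.Ioi (0 : ℝ), deriv β s = L (deriv α s) := by
    intro s hs
    obtain ⟨-, -, mα⟩ := hdet α hα hα1 hακ s hs
    have hmat : (F β s).transpose = Q * (F α s).transpose := by
      rw [← hconst s hs, Matrix.mul_assoc, mα, Matrix.mul_one]
    rw [hL, orthogonalIsometry_apply]
    ext i
    have hi := congrFun (congrFun hmat i) 0
    simpa [hF, frameMatrix, Matrix.mul_apply, Matrix.mulVec, dotProduct] using hi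
  have hdiff : ∀ s ∈ Set.Ioi (0 : ℝ), HasDerivAt (fun u => β u - L (α u)) 0 s := by
    intro s hs
    have h := (hasDerivAt_of_contDiffOn hU hβ hs).sub
      (L.toContinuousLinearEquiv.toContinuousLinearMap.hasFDerivAt.comp_hasDerivAt s
        (hasDerivAt_of_contDiffOn hU hα hs))
    refine h.congr_deriv ?_
    rw [htan s hs]
    exact sub_self _
  refine ⟨L.toAffineIsometryEquiv.trans (AffineIsometryEquiv.constVAdd ℝ E3 (β 1 - L (α 1))),
    ?_, ?_⟩
  · have : (L.toAffineIsometryEquiv.trans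
        (AffineIsometryEquiv.constVAdd ℝ E3 (β 1 - L (α 1)))).linearIsometryEquiv = L := by
      ext x : 1
      rfl
    rw [this, hL, det_orthogonalIsometry, hQd]
    exact one_pos
  · intro s hs
    have h := hU.is_const_of_deriv_eq_zero isPreconnected_Ioi
      (fun u hu => (hdiff u hu).differentiableAt.differentiableWithinAt)
      (fun u hu => (hdiff u hu).deriv) (Set.mem_Ioi.mpr hs) h1
    have h' : β s = (β 1 - L (α 1)) + L (α s) := by rw [← h]; simp
    exact h'

lemma spaceCurvature_ne_zero {α : ℝ → E3} (hα : IsGeneratingCurve α) :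
    ∀ s ∈ Set.Ioi (0 : ℝ), spaceCurvature α s ≠ 0 := by
  intro s hs
  have hs' : (0 : ℝ) < s := hs
  rw [hα.curvature s hs]
  positivity

lemma rigidlyCongruent_of_isGeneratingCurve {α β : ℝ → E3} (hα : IsGeneratingCurve α)
    (hβ : IsGeneratingCurve β) : RigidlyCongruent α β :=
  rigidlyCongruent_of_eq_curvature_torsion hα.smooth hβ.smooth hα.unitSpeed hβ.unitSpeed
    (spaceCurvature_ne_zero hα)
    (fun s hs => (hβ.curvature s hs).trans (hα.curvature s hs).symm)
    (fun s hs => (hβ.torsion s hs).trans (hα.torsion s hs).symm)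

/-! ### The conical helix -/

/-- The curve with unit tangent `(k cos (w log s), k sin (w log s), b) / w`. For `w² = k² + b²`, its
curvature is `k / s` and its torsion `b / s`. -/
def conicalHelix (k b w : ℝ) (s : ℝ) : E3 :=
  !₂[k / w * (s * (Real.cos (w * Real.log s) + w * Real.sin (w * Real.log s)) / (1 + w ^ 2)),
    k / w * (s * (Real.sin (w * Real.log s) - w * Real.cos (w * Real.log s)) / (1 + w ^ 2)),
    b / w * s]

section ConicalHelix

variable {k b w s : ℝ}

lemma hasDerivAt_cos_log (hs : 0 < s) : HasDerivAt (fun u => Real.cos (w * Real.log u))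
    (-(w / s) * Real.sin (w * Real.log s)) s := by
  refine ((Real.hasDerivAt_log hs.ne').const_mul w).cos.congr_deriv ?_
  ring

lemma hasDerivAt_sin_log (hs : 0 < s) : HasDerivAt (fun u => Real.sin (w * Real.log u))
    (w / s * Real.cos (w * Real.log s)) s := by
  refine ((Real.hasDerivAt_log hs.ne').const_mul w).sin.congr_deriv ?_
  ring

lemma contDiffOn_conicalHelix : ContDiffOn ℝ ∞ (conicalHelix k b w) (Set.Ioi 0) := by
  have hl : ContDiffOn ℝ ∞ (fun u : ℝ => w * Real.log u) (Set.Ioi 0) :=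
    contDiffOn_const.mul (Real.contDiffOn_log.mono fun x hx => ne_of_gt hx)
  have hc := hl.cos
  have hsn := hl.sin
  rw [contDiffOn_euclidean]
  intro i
  fin_cases i
  · exact contDiffOn_const.mul
      ((contDiffOn_id.mul (hc.add (contDiffOn_const.mul hsn))).div_const _)
  · exact contDiffOn_const.mul
      ((contDiffOn_id.mul (hsn.sub (contDiffOn_const.mul hc))).div_const _)
  · exact contDiffOn_const.mul contDiffOn_id

lemma hasDerivAt_conicalHelix (hs : 0 < s) : HasDerivAt (conicalHelix k b w)
    !₂[k / w * Real.cos (w * Real.log s), k / w * Real.sin (w * Real.log s), b / w] s := by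
  have hc := hasDerivAt_cos_log (w := w) hs
  have hsn := hasDerivAt_sin_log (w := w) hs
  have hw : (1 + w ^ 2) ≠ 0 := by positivity
  rw [hasDerivAt_E3_iff]
  intro i
  fin_cases i
  · refine ((((hasDerivAt_id s).mul (hc.add (hsn.const_mul w))).div_const
      (1 + w ^ 2)).const_mul (k / w)).congr_deriv ?_
    refine congrArg (k / w * ·) ?_
    simp
    field_simp
    ring
  · refine ((((hasDerivAt_id s).mul (hsn.sub (hc.const_mul w))).div_const
      (1 + w ^ 2)).const_mul (k / w)).congr_deriv ?_
    refine congrArg (k / w * ·) ?_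
    simp
    field_simp
    ring
  · refine ((hasDerivAt_id s).const_mul (b / w)).congr_deriv ?_
    simp

lemma hasDerivAt_deriv_conicalHelix (hw : w ≠ 0) (hs : 0 < s) :
    HasDerivAt (deriv (conicalHelix k b w))
      !₂[-(k / s) * Real.sin (w * Real.log s), k / s * Real.cos (w * Real.log s), 0] s := by
  have h : HasDerivAt (fun u => (!₂[k / w * Real.cos (w * Real.log u),
      k / w * Real.sin (w * Real.log u), b / w] : E3))
      !₂[-(k / s) * Real.sin (w * Real.log s), k / s * Real.cos (w * Real.log s), 0] s := by
    rw [hasDerivAt_E3_iff]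
    intro i
    fin_cases i
    · refine ((hasDerivAt_cos_log hs).const_mul (k / w)).congr_deriv ?_
      simp
      field_simp
    · refine ((hasDerivAt_sin_log hs).const_mul (k / w)).congr_deriv ?_
      simp
      field_simp
    · exact hasDerivAt_const s (b / w)
  exact h.congr_of_eventuallyEq (Filter.eventually_of_mem (Ioi_mem_nhds hs) fun u hu =>
    (hasDerivAt_conicalHelix hu).deriv)

lemma iteratedDeriv_two_conicalHelix (hw : w ≠ 0) (hs : 0 < s) :
    iteratedDeriv 2 (conicalHelix k b w) s
      = !₂[-(k / s) * Real.sin (w * Real.log s), k / s * Real.cos (w * Real.log s), 0] := by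
  rw [iteratedDeriv_two_eq, (hasDerivAt_deriv_conicalHelix hw hs).deriv]

lemma iteratedDeriv_three_conicalHelix (hw : w ≠ 0) (hs : 0 < s) :
    iteratedDeriv 3 (conicalHelix k b w) s
      = !₂[k / s ^ 2 * (Real.sin (w * Real.log s) - w * Real.cos (w * Real.log s)),
          -(k / s ^ 2) * (Real.cos (w * Real.log s) + w * Real.sin (w * Real.log s)), 0] := by
  have hinv : HasDerivAt (fun u : ℝ => k / u) (-(k / s ^ 2)) s := by
    refine ((hasDerivAt_inv hs.ne').const_mul k).congr_deriv ?_
    field_simp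
  have h : HasDerivAt (fun u => (!₂[-(k / u) * Real.sin (w * Real.log u),
      k / u * Real.cos (w * Real.log u), 0] : E3))
      !₂[k / s ^ 2 * (Real.sin (w * Real.log s) - w * Real.cos (w * Real.log s)),
        -(k / s ^ 2) * (Real.cos (w * Real.log s) + w * Real.sin (w * Real.log s)), 0] s := by
    rw [hasDerivAt_E3_iff]
    intro i
    fin_cases i
    · refine (hinv.neg.mul (hasDerivAt_sin_log hs)).congr_deriv ?_
      simp
      field_simp
      ring
    · refine (hinv.mul (hasDerivAt_cos_log hs)).congr_deriv ?_
      simp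
      field_simp
      ring
    · exact hasDerivAt_const s 0
  rw [iteratedDeriv_succ]
  exact (h.congr_of_eventuallyEq (Filter.eventually_of_mem (Ioi_mem_nhds hs) fun u hu =>
    iteratedDeriv_two_conicalHelix hw hu)).deriv

lemma norm_deriv_conicalHelix (hw : w ≠ 0) (h : w ^ 2 = k ^ 2 + b ^ 2) (hs : 0 < s) :
    ‖deriv (conicalHelix k b w) s‖ = 1 := by
  rw [(hasDerivAt_conicalHelix hs).deriv, norm_eq_one_iff_E3]
  simp
  field_simp
  have := Real.sin_sq_add_cos_sq (w * Real.log s)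
  linear_combination k ^ 2 * this - h

lemma spaceCurvature_conicalHelix (hk : 0 ≤ k) (hw : w ≠ 0) (hs : 0 < s) :
    spaceCurvature (conicalHelix k b w) s = k / s := by
  rw [spaceCurvature, iteratedDeriv_two_conicalHelix hw hs, EuclideanSpace.norm_eq,
    Real.sqrt_eq_iff_mul_self_eq (by positivity) (by positivity)]
  simp [Fin.sum_univ_three]
  linear_combination (k / s) ^ 2 * Real.sin_sq_add_cos_sq (w * Real.log s)

lemma spaceTorsion_conicalHelix (hk : 0 < k) (hw : w ≠ 0) (hs : 0 < s) :
    spaceTorsion (conicalHelix k b w) s = b / s := by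
  rw [spaceTorsion, spaceCurvature_conicalHelix hk.le hw hs, (hasDerivAt_conicalHelix hs).deriv,
    iteratedDeriv_two_conicalHelix hw hs, iteratedDeriv_three_conicalHelix hw hs,
    Matrix.det_fin_three]
  simp
  field_simp
  linear_combination b * w * Real.sin_sq_add_cos_sq (w * Real.log s)

end ConicalHelix

lemma exists_isGeneratingCurve : ∃ α : ℝ → E3, IsGeneratingCurve α := by
  have h5 : Real.sqrt 5 ^ 2 = 5 := Real.sq_sqrt (by norm_num)
  have h7 : Real.sqrt 7 ^ 2 = 7 := Real.sq_sqrt (by norm_num)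
  have h83 : Real.sqrt (83 / 4) ^ 2 = 83 / 4 := Real.sq_sqrt (by norm_num)
  have hw : Real.sqrt (83 / 4) ≠ 0 := by positivity
  refine ⟨conicalHelix (Real.sqrt 5) (3 * Real.sqrt 7 / 2) (Real.sqrt (83 / 4)),
    contDiffOn_conicalHelix, fun s hs => norm_deriv_conicalHelix hw ?_ hs,
    fun s hs => spaceCurvature_conicalHelix (Real.sqrt_nonneg 5) hw hs, fun s hs => ?_⟩
  · rw [h83, div_pow, mul_pow, h5, h7]
    norm_num
  · rw [spaceTorsion_conicalHelix (by positivity) hw hs, div_div]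

/-! ### Partial derivatives -/

section PartialDeriv

variable {ι : Type*} [DecidableEq ι] {F : Type*} [NormedAddCommGroup F] [NormedSpace ℝ F]

/-- A partial derivative is the one-variable derivative in the given coordinate. -/
lemma partialDeriv_eq_of_hasDerivAt_update [Fintype ι] {f : (ι → ℝ) → F} {p : ι → ℝ} {i : ι}
    {f' : F}
    (hf : DifferentiableAt ℝ f p)
    (h : HasDerivAt (fun u => f (Function.update p i u)) f' (p i)) :
    partialDeriv i f p = f' := by
  have h1 := hasDerivAt_update p i (p i)
  have h2 : HasFDerivAt f (fderiv ℝ f p) (Function.update p i (p i)) := by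
    rw [Function.update_eq_self]
    exact hf.hasFDerivAt
  exact (h2.comp_hasDerivAt (p i) h1).unique h

lemma partialDeriv_const (c : F) (i : ι) (p : ι → ℝ) :
    partialDeriv i (fun _ : ι → ℝ => c) p = 0 := by
  simp [partialDeriv]

lemma partialDeriv_congr {U : Set (ι → ℝ)} (hU : IsOpen U) {f g : (ι → ℝ) → F}
    (h : ∀ q ∈ U, f q = g q) {p : ι → ℝ} (hp : p ∈ U) (i : ι) :
    partialDeriv i f p = partialDeriv i g p := by
  unfold partialDeriv
  rw [Filter.EventuallyEq.fderiv_eq (Filter.eventually_of_mem (hU.mem_nhds hp) h)]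

lemma christoffel_congr [Fintype ι] {U : Set (ι → ℝ)} (hU : IsOpen U) {g h : (ι → ℝ) → Matrix ι ι ℝ}
    (hgh : ∀ q ∈ U, g q = h q) {p : ι → ℝ} (hp : p ∈ U) (k i j : ι) :
    christoffel g k i j p = christoffel h k i j p := by
  have hd : ∀ a b c, partialDeriv a (fun q => g q b c) p = partialDeriv a (fun q => h q b c) p :=
    fun a b c => partialDeriv_congr hU (fun q hq => by rw [hgh q hq]) hp a
  simp only [christoffel, hd, hgh p hp]

end PartialDeriv

/-! ### The surface of principal normals -/

lemma isOpen_surfaceDomain : IsOpen surfaceDomain :=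
  isOpen_lt continuous_const (continuous_apply 0)

section Surface

variable {α : ℝ → E3}

lemma contDiffOn_ruledSurface (hα : ContDiffOn ℝ ∞ α (Set.Ioi 0))
    (hκ : ∀ s ∈ Set.Ioi (0 : ℝ), spaceCurvature α s ≠ 0) :
    ContDiffOn ℝ ∞ (ruledSurface α) surfaceDomain := by
  have h0 : ContDiffOn ℝ ∞ (fun p : Fin 2 → ℝ => p 0) surfaceDomain :=
    (contDiff_apply ℝ ℝ (0 : Fin 2)).contDiffOn
  have h1 : ContDiffOn ℝ ∞ (fun p : Fin 2 → ℝ => p 1) surfaceDomain :=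
    (contDiff_apply ℝ ℝ (1 : Fin 2)).contDiffOn
  have hm : Set.MapsTo (fun p : Fin 2 → ℝ => p 0) surfaceDomain (Set.Ioi 0) := fun p hp => hp
  exact (hα.comp h0 hm).add (h1.smul ((contDiffOn_principalNormal isOpen_Ioi hα hκ).comp h0 hm))

lemma differentiableAt_ruledSurface (hα : ContDiffOn ℝ ∞ α (Set.Ioi 0))
    (hκ : ∀ s ∈ Set.Ioi (0 : ℝ), spaceCurvature α s ≠ 0) {p : Fin 2 → ℝ}
    (hp : p ∈ surfaceDomain) : DifferentiableAt ℝ (ruledSurface α) p :=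
  ((contDiffOn_ruledSurface hα hκ).contDiffAt
    (isOpen_surfaceDomain.mem_nhds hp)).differentiableAt (by simp)

lemma partialDeriv_zero_ruledSurface (hα : ContDiffOn ℝ ∞ α (Set.Ioi 0))
    (h1 : ∀ s ∈ Set.Ioi (0 : ℝ), ‖deriv α s‖ = 1)
    (hκ : ∀ s ∈ Set.Ioi (0 : ℝ), spaceCurvature α s ≠ 0) {p : Fin 2 → ℝ}
    (hp : p ∈ surfaceDomain) :
    partialDeriv 0 (ruledSurface α) p = (1 - p 1 * spaceCurvature α (p 0)) • deriv α (p 0)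
      + (p 1 * spaceTorsion α (p 0)) • binormal α (p 0) := by
  have hp' : p 0 ∈ Set.Ioi (0 : ℝ) := hp
  refine partialDeriv_eq_of_hasDerivAt_update (differentiableAt_ruledSurface hα hκ hp) ?_
  have h : HasDerivAt (fun u => α u + p 1 • principalNormal α u) _ (p 0) :=
    (hasDerivAt_of_contDiffOn isOpen_Ioi hα hp').add
      ((hasDerivAt_principalNormal isOpen_Ioi hα h1 hκ hp').const_smul (p 1))
  have hf : (fun u => ruledSurface α (Function.update p 0 u))
      = fun u => α u + p 1 • principalNormal α u := by
    funext u
    simp [ruledSurface]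
  rw [hf]
  refine h.congr_deriv ?_
  module

lemma partialDeriv_one_ruledSurface (hα : ContDiffOn ℝ ∞ α (Set.Ioi 0))
    (hκ : ∀ s ∈ Set.Ioi (0 : ℝ), spaceCurvature α s ≠ 0) {p : Fin 2 → ℝ}
    (hp : p ∈ surfaceDomain) :
    partialDeriv 1 (ruledSurface α) p = principalNormal α (p 0) := by
  refine partialDeriv_eq_of_hasDerivAt_update (differentiableAt_ruledSurface hα hκ hp) ?_
  have h : HasDerivAt (fun u : ℝ => α (p 0) + u • principalNormal α (p 0)) _ (p 1) :=
    ((hasDerivAt_id (p 1)).smul_const (principalNormal α (p 0))).const_add (α (p 0))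
  have hf : (fun u => ruledSurface α (Function.update p 1 u))
      = fun u => α (p 0) + u • principalNormal α (p 0) := by
    funext u
    simp [ruledSurface]
  rw [hf]
  exact h.congr_deriv (one_smul _ _)

/-- The metric of the surface of principal normals is
`((1 - tκ)² + (tτ)²) ds² + dt²`. -/
lemma inducedMetric_ruledSurface (hα : ContDiffOn ℝ ∞ α (Set.Ioi 0))
    (h1 : ∀ s ∈ Set.Ioi (0 : ℝ), ‖deriv α s‖ = 1)
    (hκ : ∀ s ∈ Set.Ioi (0 : ℝ), spaceCurvature α s ≠ 0) {p : Fin 2 → ℝ}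
    (hp : p ∈ surfaceDomain) :
    inducedMetric (ruledSurface α) p = Matrix.diagonal
      ![(1 - p 1 * spaceCurvature α (p 0)) ^ 2 + (p 1 * spaceTorsion α (p 0)) ^ 2, 1] := by
  have hp' : p 0 ∈ Set.Ioi (0 : ℝ) := hp
  have hTN := inner_deriv_principalNormal isOpen_Ioi hα h1 hp'
  have hTT : inner ℝ (deriv α (p 0)) (deriv α (p 0)) = (1 : ℝ) := by
    rw [real_inner_self_eq_norm_sq, h1 _ hp', one_pow]
  have hn := norm_principalNormal (hκ _ hp')
  have hNN : inner ℝ (principalNormal α (p 0)) (principalNormal α (p 0)) = (1 : ℝ) := by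
    rw [real_inner_self_eq_norm_sq, hn, one_pow]
  have hTB : inner ℝ (deriv α (p 0)) (binormal α (p 0)) = (0 : ℝ) := inner_crossE3_left
  have hNB : inner ℝ (principalNormal α (p 0)) (binormal α (p 0)) = (0 : ℝ) :=
    inner_crossE3_right
  have hBB : inner ℝ (binormal α (p 0)) (binormal α (p 0)) = (1 : ℝ) :=
    inner_crossE3_self (h1 _ hp') hn hTN
  have hNT := (real_inner_comm (deriv α (p 0)) (principalNormal α (p 0))).trans hTN
  have hBT := (real_inner_comm (deriv α (p 0)) (binormal α (p 0))).trans hTB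
  have hBN := (real_inner_comm (principalNormal α (p 0)) (binormal α (p 0))).trans hNB
  have e0 := partialDeriv_zero_ruledSurface hα h1 hκ hp
  have e1 := partialDeriv_one_ruledSurface hα hκ hp
  ext i j
  fin_cases i <;> fin_cases j <;>
    simp [-inner_self_eq_norm_sq_to_K, inducedMetric, e0, e1, inner_add_left,
      inner_add_right, inner_smul_left, inner_smul_right, hTN, hTT, hNN, hTB, hNB, hBB, hNT, hBT,
      hBN]
  ring

lemma isImmersedSurface_ruledSurface (hα : ContDiffOn ℝ ∞ α (Set.Ioi 0))
    (h1 : ∀ s ∈ Set.Ioi (0 : ℝ), ‖deriv α s‖ = 1)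
    (hκ : ∀ s ∈ Set.Ioi (0 : ℝ), spaceCurvature α s ≠ 0)
    (hτ : ∀ s ∈ Set.Ioi (0 : ℝ), spaceTorsion α s ≠ 0) :
    IsImmersedSurface surfaceDomain (ruledSurface α) := by
  refine ⟨isOpen_surfaceDomain, contDiffOn_ruledSurface hα hκ, fun p hp => ?_⟩
  have hg := inducedMetric_ruledSurface hα h1 hκ hp
  have h00 := congrFun (congrFun hg 0) 0
  have h01 := congrFun (congrFun hg 0) 1
  have h11 := congrFun (congrFun hg 1) 1
  simp [inducedMetric, -inner_self_eq_norm_sq_to_K] at h00 h01 h11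
  rw [injective_iff_map_eq_zero]
  intro v hv
  have hv' : v 0 • partialDeriv 0 (ruledSurface α) p + v 1 • partialDeriv 1 (ruledSurface α) p
      = 0 := by
    rw [partialDeriv, partialDeriv, ← map_smul, ← map_smul, ← map_add, ← hv]
    congr 1
    ext i
    fin_cases i <;> simp
  have hE : 0 < (1 - p 1 * spaceCurvature α (p 0)) ^ 2 + (p 1 * spaceTorsion α (p 0)) ^ 2 := by
    by_cases ht : p 1 = 0
    · simp [ht]
    · have := hτ (p 0) hp
      positivity
  have i0 := congrArg (fun w => (inner ℝ (partialDeriv 0 (ruledSurface α) p) w : ℝ)) hv'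
  have i1 := congrArg (fun w => (inner ℝ (partialDeriv 1 (ruledSurface α) p) w : ℝ)) hv'
  simp only [inner_add_right, inner_smul_right, inner_zero_right] at i0 i1
  have h10 := (real_inner_comm _ _).trans h01
  rw [h10, mul_zero, zero_add, h11] at i1
  rw [h01, mul_zero, add_zero, h00] at i0
  ext i
  fin_cases i
  · exact (mul_eq_zero.mp i0).resolve_right hE.ne'
  · simpa using i1

end Surface

/-! ### Metrics `E(s,t) ds² + dt² + |dy|²` -/

section Strip

variable {m : ℕ}

/-- The metric `E(s,t) ds² + dt² + |dy|²` on `ℝ² × ℝ^m`. -/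
def stripMetric (E : ℝ → ℝ → ℝ) (m : ℕ) (p : Fin 2 ⊕ Fin m → ℝ) :
    Matrix (Fin 2 ⊕ Fin m) (Fin 2 ⊕ Fin m) ℝ :=
  Matrix.diagonal (Sum.elim ![E (p (Sum.inl 0)) (p (Sum.inl 1)), 1] 1)

/-- The components of `∂/∂s`. -/
def dirS (m : ℕ) : Fin 2 ⊕ Fin m → ℝ := Sum.elim ![1, 0] 0

/-- The components of `∂/∂t`. -/
def dirT (m : ℕ) : Fin 2 ⊕ Fin m → ℝ := Sum.elim ![0, 1] 0

lemma partialDeriv_stripMetric {E : ℝ → ℝ → ℝ} {p : Fin 2 ⊕ Fin m → ℝ} {Es Et : ℝ}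
    (hE : DifferentiableAt ℝ (fun q : Fin 2 ⊕ Fin m → ℝ => E (q (Sum.inl 0)) (q (Sum.inl 1))) p)
    (hs : HasDerivAt (fun u => E u (p (Sum.inl 1))) Es (p (Sum.inl 0)))
    (ht : HasDerivAt (fun u => E (p (Sum.inl 0)) u) Et (p (Sum.inl 1)))
    (i j l : Fin 2 ⊕ Fin m) :
    partialDeriv i (fun q => stripMetric E m q j l) p
      = (dirS m i * Es + dirT m i * Et) * (dirS m j * dirS m l) := by
  by_cases h : j = Sum.inl 0 ∧ l = Sum.inl 0
  · obtain ⟨rfl, rfl⟩ := h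
    simp only [stripMetric, Matrix.diagonal_apply_eq, Sum.elim_inl, Matrix.cons_val_zero]
    refine partialDeriv_eq_of_hasDerivAt_update hE ?_
    rcases i with i | i
    · fin_cases i
      · simpa [dirS, dirT] using hs
      · simpa [dirS, dirT] using ht
    · simpa [dirS, dirT] using hasDerivAt_const (p (Sum.inr i)) _
  · have h0 : dirS m j * dirS m l = 0 := by
      by_contra hne
      refine h ⟨?_, ?_⟩
      · rcases j with j | j
        · fin_cases j <;> simp [dirS] at hne ⊢
        · simp [dirS] at hne
      · rcases l with l | l
        · fin_cases l <;> simp [dirS] at hne ⊢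
        · simp [dirS] at hne
    have hc : (fun q => stripMetric E m q j l) = fun _ => stripMetric E m p j l := by
      funext q
      by_cases hjl : j = l
      · subst hjl
        simp only [stripMetric, Matrix.diagonal_apply_eq]
        rcases j with j | j
        · fin_cases j <;> simp at h ⊢
        · rfl
      · simp [stripMetric, Matrix.diagonal_apply_ne _ hjl]
    rw [h0, mul_zero, hc, partialDeriv_const]

/-- The only Christoffel symbols of `E ds² + dt² + |dy|²` that may be nonzero are
`Γ^s_ss = E_s / 2E`, `Γ^s_st = Γ^s_ts = E_t / 2E` and `Γ^t_ss = - E_t / 2`. -/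
lemma christoffel_stripMetric {E : ℝ → ℝ → ℝ} {p : Fin 2 ⊕ Fin m → ℝ} {Es Et : ℝ}
    (h0 : E (p (Sum.inl 0)) (p (Sum.inl 1)) ≠ 0)
    (hE : DifferentiableAt ℝ (fun q : Fin 2 ⊕ Fin m → ℝ => E (q (Sum.inl 0)) (q (Sum.inl 1))) p)
    (hs : HasDerivAt (fun u => E u (p (Sum.inl 1))) Es (p (Sum.inl 0)))
    (ht : HasDerivAt (fun u => E (p (Sum.inl 0)) u) Et (p (Sum.inl 1)))
    (k i j : Fin 2 ⊕ Fin m) :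
    christoffel (stripMetric E m) k i j p
      = Es / (2 * E (p (Sum.inl 0)) (p (Sum.inl 1))) * (dirS m k * dirS m i * dirS m j)
        + Et / (2 * E (p (Sum.inl 0)) (p (Sum.inl 1)))
          * (dirS m k * (dirT m i * dirS m j + dirS m i * dirT m j))
        + -(Et / 2) * (dirT m k * dirS m i * dirS m j) := by
  have hinv : (stripMetric E m p)⁻¹
      = Matrix.diagonal (Sum.elim ![(E (p (Sum.inl 0)) (p (Sum.inl 1)))⁻¹, 1] 1) := by
    refine Matrix.inv_eq_right_inv ?_
    rw [stripMetric, Matrix.diagonal_mul_diagonal, ← Matrix.diagonal_one]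
    congr 1
    funext i
    rcases i with i | i
    · fin_cases i <;> simp [h0]
    · simp
  simp only [christoffel, hinv, partialDeriv_stripMetric hE hs ht, Matrix.diagonal_apply,
    ite_mul, zero_mul, Finset.sum_ite_eq, Finset.mem_univ, if_true]
  rcases k with k | k
  · fin_cases k
    · simp [dirS, dirT]
      field_simp
      ring
    · simp [dirS, dirT]
      ring
  · simp [dirS, dirT]

end Strip

/-! ### The metric for curvature `k / s` and torsion `b / s` -/

section Cone

/-- The coefficient `(1 - tκ)² + (tτ)²` for `κ = k / s` and `τ = b / s`. -/
def coneCoeff (k b s t : ℝ) : ℝ := (1 - t * (k / s)) ^ 2 + (t * (b / s)) ^ 2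

/-- The derivative of `coneCoeff` in `s`. -/
def coneCoeffS (k b s t : ℝ) : ℝ :=
  2 * (1 - t * (k / s)) * (t * (k / s ^ 2)) - 2 * (t * (b / s)) * (t * (b / s ^ 2))

/-- The derivative of `coneCoeff` in `t`. -/
def coneCoeffT (k b s t : ℝ) : ℝ :=
  -(2 * (1 - t * (k / s)) * (k / s)) + 2 * (t * (b / s)) * (b / s)

variable {k b s t : ℝ} {m : ℕ}

lemma coneCoeff_pos (hb : b ≠ 0) (hs : 0 < s) : 0 < coneCoeff k b s t := by
  unfold coneCoeff
  by_cases ht : t = 0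
  · simp [ht]
  · positivity

lemma coneCoeff_zero : coneCoeff k b s 0 = 1 := by simp [coneCoeff]

lemma coneCoeffS_zero : coneCoeffS k b s 0 = 0 := by simp [coneCoeffS]

lemma coneCoeffT_zero : coneCoeffT k b s 0 = -(2 * (k / s)) := by simp [coneCoeffT]

lemma hasDerivAt_const_div (c : ℝ) (hs : 0 < s) :
    HasDerivAt (fun u : ℝ => c / u) (-(c / s ^ 2)) s := by
  refine ((hasDerivAt_inv hs.ne').const_mul c).congr_deriv ?_
  field_simp

lemma hasDerivAt_coneCoeff_left (hs : 0 < s) :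
    HasDerivAt (fun u => coneCoeff k b u t) (coneCoeffS k b s t) s := by
  refine (((((hasDerivAt_const_div k hs).const_mul t).const_sub 1).pow 2).add
    (((hasDerivAt_const_div b hs).const_mul t).pow 2)).congr_deriv ?_
  simp [coneCoeffS]
  ring

lemma hasDerivAt_coneCoeff_right :
    HasDerivAt (fun u => coneCoeff k b s u) (coneCoeffT k b s t) t := by
  refine (((((hasDerivAt_id t).mul_const (k / s)).const_sub 1).pow 2).add
    (((hasDerivAt_id t).mul_const (b / s)).pow 2)).congr_deriv ?_
  simp [coneCoeffT]

lemma hasDerivAt_coneCoeffS_right :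
    HasDerivAt (fun u => coneCoeffS k b s u) (2 * (k / s ^ 2)) 0 := by
  refine (((((hasDerivAt_id (0 : ℝ)).mul_const (k / s)).const_sub 1).const_mul 2 |>.mul
    ((hasDerivAt_id (0 : ℝ)).mul_const (k / s ^ 2))).sub
    (((hasDerivAt_id (0 : ℝ)).mul_const (b / s)).const_mul 2 |>.mul
    ((hasDerivAt_id (0 : ℝ)).mul_const (b / s ^ 2)))).congr_deriv ?_
  simp

lemma hasDerivAt_coneCoeffT_right :
    HasDerivAt (fun u => coneCoeffT k b s u) (2 * ((k / s) ^ 2 + (b / s) ^ 2)) 0 := by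
  refine (((((hasDerivAt_id (0 : ℝ)).mul_const (k / s)).const_sub 1).const_mul 2 |>.mul_const
    (k / s)).neg.add
    (((hasDerivAt_id (0 : ℝ)).mul_const (b / s)).const_mul 2 |>.mul_const
    (b / s))).congr_deriv ?_
  simp
  ring

lemma isOpen_productDomain : IsOpen (productDomain surfaceDomain m) :=
  isOpen_surfaceDomain.preimage (continuous_pi fun i => continuous_apply (Sum.inl i))

lemma contDiffOn_div_coord (c : ℝ) : ContDiffOn ℝ ∞
    (fun p : Fin 2 ⊕ Fin m → ℝ => c / p (Sum.inl 0)) (productDomain surfaceDomain m) :=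
  contDiffOn_const.div (contDiff_apply ℝ ℝ (Sum.inl 0 : Fin 2 ⊕ Fin m)).contDiffOn
    fun p hp => ne_of_gt (show 0 < p (Sum.inl 0) from hp)

lemma contDiffOn_coord (i : Fin 2 ⊕ Fin m) (U : Set (Fin 2 ⊕ Fin m → ℝ)) :
    ContDiffOn ℝ ∞ (fun p : Fin 2 ⊕ Fin m → ℝ => p i) U :=
  (contDiff_apply ℝ ℝ i).contDiffOn

lemma contDiffOn_coneCoeff : ContDiffOn ℝ ∞
    (fun p : Fin 2 ⊕ Fin m → ℝ => coneCoeff k b (p (Sum.inl 0)) (p (Sum.inl 1)))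
    (productDomain surfaceDomain m) :=
  ((contDiffOn_const.sub ((contDiffOn_coord _ _).mul (contDiffOn_div_coord k))).pow 2).add
    (((contDiffOn_coord _ _).mul (contDiffOn_div_coord b)).pow 2)

lemma contDiffOn_coneCoeffT : ContDiffOn ℝ ∞
    (fun p : Fin 2 ⊕ Fin m → ℝ => coneCoeffT k b (p (Sum.inl 0)) (p (Sum.inl 1)))
    (productDomain surfaceDomain m) :=
  (((contDiffOn_const.mul (contDiffOn_const.sub
    ((contDiffOn_coord _ _).mul (contDiffOn_div_coord k)))).mul (contDiffOn_div_coord k)).neg).add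
    ((contDiffOn_const.mul ((contDiffOn_coord _ _).mul (contDiffOn_div_coord b))).mul
      (contDiffOn_div_coord b))

lemma contDiffOn_div_sq_coord (c : ℝ) : ContDiffOn ℝ ∞
    (fun p : Fin 2 ⊕ Fin m → ℝ => c / p (Sum.inl 0) ^ 2) (productDomain surfaceDomain m) :=
  contDiffOn_const.div ((contDiffOn_coord _ _).pow 2)
    fun p hp => pow_ne_zero 2 (ne_of_gt (show 0 < p (Sum.inl 0) from hp))

lemma contDiffOn_coneCoeffS : ContDiffOn ℝ ∞
    (fun p : Fin 2 ⊕ Fin m → ℝ => coneCoeffS k b (p (Sum.inl 0)) (p (Sum.inl 1)))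
    (productDomain surfaceDomain m) :=
  ((contDiffOn_const.mul (contDiffOn_const.sub
    ((contDiffOn_coord _ _).mul (contDiffOn_div_coord k)))).mul
      ((contDiffOn_coord _ _).mul (contDiffOn_div_sq_coord k))).sub
    ((contDiffOn_const.mul ((contDiffOn_coord _ _).mul (contDiffOn_div_coord b))).mul
      ((contDiffOn_coord _ _).mul (contDiffOn_div_sq_coord b)))

lemma differentiableAt_of_contDiffOn_productDomain {f : (Fin 2 ⊕ Fin m → ℝ) → ℝ}
    (hf : ContDiffOn ℝ ∞ f (productDomain surfaceDomain m)) {p : Fin 2 ⊕ Fin m → ℝ}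
    (hp : p ∈ productDomain surfaceDomain m) : DifferentiableAt ℝ f p :=
  (hf.contDiffAt (isOpen_productDomain.mem_nhds hp)).differentiableAt (by simp)

lemma isRiemannianMetric_of_eq_stripMetric {g : (Fin 2 ⊕ Fin m → ℝ) →
      Matrix (Fin 2 ⊕ Fin m) (Fin 2 ⊕ Fin m) ℝ} (hb : b ≠ 0)
    (hg : ∀ p ∈ productDomain surfaceDomain m, g p = stripMetric (coneCoeff k b) m p) :
    IsRiemannianMetric (productDomain surfaceDomain m) g := by
  refine ⟨isOpen_productDomain, fun i j => ?_, fun p hp => ?_⟩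
  · refine ContDiffOn.congr (f := fun p => stripMetric (coneCoeff k b) m p i j) ?_
      fun p hp => by rw [hg p hp]
    by_cases hij : i = j
    · subst hij
      simp only [stripMetric, Matrix.diagonal_apply_eq]
      rcases i with i | i
      · fin_cases i
        · exact contDiffOn_coneCoeff
        · exact contDiffOn_const
      · exact contDiffOn_const
    · simp only [stripMetric, Matrix.diagonal_apply_ne _ hij]
      exact contDiffOn_const
  · rw [hg p hp, stripMetric, Matrix.posDef_diagonal_iff]
    rintro (i | i)
    · fin_cases i
      · exact coneCoeff_pos hb hp
      · simp
    · simp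

/-- The Christoffel symbols of the metric `coneCoeff k b s t ds² + dt² + |dy|²`. -/
def coneChristoffel (k b : ℝ) (m : ℕ) (l i j : Fin 2 ⊕ Fin m) (p : Fin 2 ⊕ Fin m → ℝ) : ℝ :=
  coneCoeffS k b (p (Sum.inl 0)) (p (Sum.inl 1))
      / (2 * coneCoeff k b (p (Sum.inl 0)) (p (Sum.inl 1))) * (dirS m l * dirS m i * dirS m j)
    + coneCoeffT k b (p (Sum.inl 0)) (p (Sum.inl 1))
      / (2 * coneCoeff k b (p (Sum.inl 0)) (p (Sum.inl 1)))
      * (dirS m l * (dirT m i * dirS m j + dirS m i * dirT m j))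
    + -(coneCoeffT k b (p (Sum.inl 0)) (p (Sum.inl 1)) / 2) * (dirT m l * dirS m i * dirS m j)

lemma christoffel_eq_coneChristoffel {g : (Fin 2 ⊕ Fin m → ℝ) →
      Matrix (Fin 2 ⊕ Fin m) (Fin 2 ⊕ Fin m) ℝ} (hb : b ≠ 0)
    (hg : ∀ p ∈ productDomain surfaceDomain m, g p = stripMetric (coneCoeff k b) m p)
    {p : Fin 2 ⊕ Fin m → ℝ} (hp : p ∈ productDomain surfaceDomain m) (l i j : Fin 2 ⊕ Fin m) :
    christoffel g l i j p = coneChristoffel k b m l i j p := by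
  have hp' : 0 < p (Sum.inl 0) := hp
  rw [christoffel_congr isOpen_productDomain hg hp, coneChristoffel]
  exact christoffel_stripMetric (coneCoeff_pos hb hp').ne'
    (differentiableAt_of_contDiffOn_productDomain contDiffOn_coneCoeff hp)
    (hasDerivAt_coneCoeff_left hp') hasDerivAt_coneCoeff_right l i j

lemma baseCurve_mem (hs : 0 < s) : baseCurve m s ∈ productDomain surfaceDomain m := hs

lemma coneChristoffel_baseCurve (l i j : Fin 2 ⊕ Fin m) :
    coneChristoffel k b m l i j (baseCurve m s)
      = -(k / s) * (dirS m l * (dirT m i * dirS m j + dirS m i * dirT m j))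
        + k / s * (dirT m l * dirS m i * dirS m j) := by
  simp [coneChristoffel, baseCurve, coneCoeff_zero, coneCoeffS_zero, coneCoeffT_zero]
  ring

lemma partialDeriv_coneChristoffel_baseCurve (hb : b ≠ 0) (hs : 0 < s)
    (i l j n : Fin 2 ⊕ Fin m) :
    partialDeriv i (coneChristoffel k b m l j n) (baseCurve m s)
      = dirS m i * (k / s ^ 2 * (dirS m l * (dirT m j * dirS m n + dirS m j * dirT m n))
          - k / s ^ 2 * (dirT m l * dirS m j * dirS m n))
        + dirT m i * (k / s ^ 2 * (dirS m l * dirS m j * dirS m n)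
          + ((b / s) ^ 2 - (k / s) ^ 2)
            * (dirS m l * (dirT m j * dirS m n + dirS m j * dirT m n))
          - ((k / s) ^ 2 + (b / s) ^ 2) * (dirT m l * dirS m j * dirS m n)) := by
  have hp := baseCurve_mem (m := m) hs
  have hne : ∀ p ∈ productDomain surfaceDomain m,
      2 * coneCoeff k b (p (Sum.inl 0)) (p (Sum.inl 1)) ≠ 0 := fun p hp =>
    mul_ne_zero two_ne_zero (coneCoeff_pos hb hp).ne'
  have hd : DifferentiableAt ℝ (coneChristoffel k b m l j n) (baseCurve m s) := by
    refine differentiableAt_of_contDiffOn_productDomain ?_ hp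
    have hE : ContDiffOn ℝ ∞ (fun p : Fin 2 ⊕ Fin m → ℝ =>
        2 * coneCoeff k b (p (Sum.inl 0)) (p (Sum.inl 1))) (productDomain surfaceDomain m) :=
      contDiffOn_const.mul contDiffOn_coneCoeff
    exact (((contDiffOn_coneCoeffS.div hE hne).mul contDiffOn_const).add
      ((contDiffOn_coneCoeffT.div hE hne).mul contDiffOn_const)).add
      ((contDiffOn_coneCoeffT.div_const 2).neg.mul contDiffOn_const)
  refine partialDeriv_eq_of_hasDerivAt_update hd ?_
  rcases i with i | i
  · fin_cases i
    · have hf : (fun u => coneChristoffel k b m l j n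
          (Function.update (baseCurve m s) (Sum.inl 0) u))
          = fun u => -(k / u) * (dirS m l * (dirT m j * dirS m n + dirS m j * dirT m n))
            + k / u * (dirT m l * dirS m j * dirS m n) := by
        funext u
        rw [← coneChristoffel_baseCurve (b := b)]
        congr 1
        funext a
        rcases a with a | a
        · fin_cases a <;> simp [baseCurve]
        · simp [baseCurve]
      have h1 := hasDerivAt_const_div k hs
      have h := (h1.neg.mul_const
        (dirS m l * (dirT m j * dirS m n + dirS m j * dirT m n))).add
        (h1.mul_const (dirT m l * dirS m j * dirS m n))
      refine HasDerivAt.congr_deriv (h.congr_of_eventuallyEq (Filter.EventuallyEq.of_eq hf)) ?_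
      simp [dirS, dirT]
      ring
    · have hEs := hasDerivAt_coneCoeffS_right (k := k) (b := b) (s := s)
      have hEt := hasDerivAt_coneCoeffT_right (k := k) (b := b) (s := s)
      have hE := (hasDerivAt_coneCoeff_right (k := k) (b := b) (s := s) (t := 0)).const_mul 2
      have hE0 : 2 * coneCoeff k b s 0 ≠ 0 := mul_ne_zero two_ne_zero (coneCoeff_pos hb hs).ne'
      have h := (((hEs.fun_div hE hE0).mul_const (dirS m l * dirS m j * dirS m n)).add
        ((hEt.fun_div hE hE0).mul_const
          (dirS m l * (dirT m j * dirS m n + dirS m j * dirT m n)))).add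
        ((hEt.div_const 2).neg.mul_const (dirT m l * dirS m j * dirS m n))
      have hf : (fun u => coneChristoffel k b m l j n
          (Function.update (baseCurve m s) (Sum.inl 1) u))
          = fun u => coneCoeffS k b s u / (2 * coneCoeff k b s u)
              * (dirS m l * dirS m j * dirS m n)
            + coneCoeffT k b s u / (2 * coneCoeff k b s u)
              * (dirS m l * (dirT m j * dirS m n + dirS m j * dirT m n))
            + -(coneCoeffT k b s u / 2) * (dirT m l * dirS m j * dirS m n) := by
        funext u
        simp [coneChristoffel, baseCurve]
      refine HasDerivAt.congr_deriv (h.congr_of_eventuallyEq (Filter.EventuallyEq.of_eq hf)) ?_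
      simp only [coneCoeff_zero, coneCoeffS_zero, coneCoeffT_zero]
      simp [dirS, dirT]
      ring
  · have hf : (fun u => coneChristoffel k b m l j n
          (Function.update (baseCurve m s) (Sum.inr i) u))
          = fun _ => coneChristoffel k b m l j n (baseCurve m s) := by
      funext u
      simp [coneChristoffel]
    rw [hf]
    simpa [dirS, dirT] using hasDerivAt_const (baseCurve m s (Sum.inr i)) _

end Cone

/-! ### The base curve -/

section BaseCurve

variable {k b s : ℝ} {m : ℕ}
  {g : (Fin 2 ⊕ Fin m → ℝ) → Matrix (Fin 2 ⊕ Fin m) (Fin 2 ⊕ Fin m) ℝ}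

lemma contDiff_baseCurve : ContDiff ℝ ∞ (baseCurve m) := by
  rw [contDiff_pi]
  rintro (i | i)
  · fin_cases i
    · exact contDiff_id
    · exact contDiff_const
  · exact contDiff_const

lemma deriv_baseCurve (s : ℝ) : deriv (baseCurve m) s = dirS m := by
  refine HasDerivAt.deriv (hasDerivAt_pi.mpr ?_)
  rintro (i | i)
  · fin_cases i
    · exact hasDerivAt_id s
    · exact hasDerivAt_const s 0
  · exact hasDerivAt_const s 0

lemma dirS_eq : dirS m = Sum.elim ![1, 0] 0 := rfl

/-- The tangent as the case `n = 0` of the fields `s⁻ⁿ (x T + y N)`. -/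
lemma deriv_baseCurve_eq (s : ℝ) :
    deriv (baseCurve m) s = Sum.elim ![1 / s ^ 0, 0 / s ^ 0] 0 := by
  rw [deriv_baseCurve, dirS_eq]
  simp

lemma metricNorm_baseCurve
    (hg : ∀ p ∈ productDomain surfaceDomain m, g p = stripMetric (coneCoeff k b) m p)
    (hs : 0 < s) (x y : ℝ) :
    metricNorm g (baseCurve m s) (Sum.elim ![x, y] 0) = Real.sqrt (x ^ 2 + y ^ 2) := by
  have h0 : baseCurve m s (Sum.inl 0) = s := rfl
  have h1 : baseCurve m s (Sum.inl 1) = 0 := rfl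
  rw [metricNorm, hg _ (baseCurve_mem hs)]
  congr 1
  simp [stripMetric, h0, h1, coneCoeff_zero, Matrix.diagonal_apply]
  ring

/-- Covariant differentiation along the base curve acts on `s⁻ⁿ (x T + y N)` as the Frenet
equations `∇_T T = κ N`, `∇_T N = -κ T` with `κ = k / s` dictate. -/
lemma covDeriv_baseCurve (hb : b ≠ 0)
    (hg : ∀ p ∈ productDomain surfaceDomain m, g p = stripMetric (coneCoeff k b) m p)
    {V : ℝ → Fin 2 ⊕ Fin m → ℝ} {n : ℕ} {x y x' y' : ℝ} (hx : -n * x - k * y = x')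
    (hy : -n * y + k * x = y') (hV : ∀ s, 0 < s → V s = Sum.elim ![x / s ^ n, y / s ^ n] 0)
    (hs : 0 < s) :
    covDeriv g (baseCurve m) V s = Sum.elim ![x' / s ^ (n + 1), y' / s ^ (n + 1)] 0 := by
  subst hx hy
  have hdiv : ∀ c : ℝ, HasDerivAt (fun u : ℝ => c / u ^ n) (-n * c / s ^ (n + 1)) s := by
    intro c
    refine (((hasDerivAt_pow n s).fun_inv (pow_ne_zero n hs.ne')).const_mul c).congr_deriv ?_
    rcases n with _ | n
    · simp
    · simp only [Nat.add_sub_cancel]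
      field_simp
      ring
  have hd : deriv V s = Sum.elim ![-n * x / s ^ (n + 1), -n * y / s ^ (n + 1)] 0 := by
    have h : HasDerivAt (fun u => (Sum.elim ![x / u ^ n, y / u ^ n] 0 : Fin 2 ⊕ Fin m → ℝ))
        (Sum.elim ![-n * x / s ^ (n + 1), -n * y / s ^ (n + 1)] 0) s := by
      rw [hasDerivAt_pi]
      rintro (i | i)
      · fin_cases i
        · exact hdiv x
        · exact hdiv y
      · exact hasDerivAt_const s 0
    exact (h.congr_of_eventuallyEq (Filter.eventually_of_mem (Ioi_mem_nhds hs) hV)).deriv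
  funext l
  simp only [covDeriv, hd, deriv_baseCurve,
    christoffel_eq_coneChristoffel hb hg (baseCurve_mem hs), coneChristoffel_baseCurve, hV s hs,
    Fintype.sum_sum_type, Fin.sum_univ_two]
  rcases l with l | l
  · fin_cases l
    · simp [dirS, dirT]
      field_simp
      ring
    · simp [dirS, dirT]
      field_simp
      ring
  · simp [dirS, dirT]

/-- `R(X,Y) T` along the base curve: the Gauss curvature of the surface there is `-(b / s)²`, the
negative of the squared torsion. -/
lemma curvatureTensor_baseCurve (hb : b ≠ 0)
    (hg : ∀ p ∈ productDomain surfaceDomain m, g p = stripMetric (coneCoeff k b) m p)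
    (hs : 0 < s) (x₀ x₁ y₀ y₁ : ℝ) :
    curvatureTensor g (baseCurve m s) (Sum.elim ![x₀, x₁] 0) (Sum.elim ![y₀, y₁] 0) (dirS m)
      = Sum.elim ![0, -(b / s) ^ 2 * (x₁ * y₀ - x₀ * y₁)] 0 := by
  have hp := baseCurve_mem (m := m) hs
  have hΓ : ∀ a l j n, partialDeriv a (christoffel g l j n) (baseCurve m s)
      = partialDeriv a (coneChristoffel k b m l j n) (baseCurve m s) := fun a l j n =>
    partialDeriv_congr isOpen_productDomain
      (fun q hq => christoffel_eq_coneChristoffel hb hg hq l j n) hp a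
  funext l
  simp only [curvatureTensor, hΓ, partialDeriv_coneChristoffel_baseCurve hb hs,
    christoffel_eq_coneChristoffel hb hg hp, coneChristoffel_baseCurve,
    Fintype.sum_sum_type, Fin.sum_univ_two]
  rcases l with l | l
  · fin_cases l
    · simp [dirS, dirT]
    · simp [dirS, dirT]
      ring
  · simp [dirS, dirT]

/-- With `κ = k / s` the tangential part of the equation forces `k² = 5`, and the normal part then
forces Gauss curvature `-63 / (4 s²)`, that is, `b² = 63 / 4`. -/
lemma isTriharmonicCurve_baseCurve (hk : k ^ 2 = 5) (hb : b ^ 2 = 63 / 4)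
    (hg : ∀ p ∈ productDomain surfaceDomain m, g p = stripMetric (coneCoeff k b) m p) :
    IsTriharmonicCurve (productDomain surfaceDomain m) g (Set.Ioi 0) (baseCurve m) := by
  have hb0 : b ≠ 0 := by
    rintro rfl
    norm_num at hb
  have hT := fun s (_ : 0 < s) => deriv_baseCurve_eq (m := m) s
  -- the components of `sⁿ ∇_Tⁿ T` for `n = 1, …, 5`, simplified with `k² = 5`
  have c1 := fun s (hs : 0 < s) =>
    covDeriv_baseCurve hb0 hg (x' := 0) (y' := k) (by simp) (by simp) hT hs
  have c2 := fun s (hs : 0 < s) => covDeriv_baseCurve hb0 hg (x' := -5) (y' := -k)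
    (by push_cast; linear_combination -hk) (by push_cast; ring) c1 hs
  have c3 := fun s (hs : 0 < s) => covDeriv_baseCurve hb0 hg (x' := 15) (y' := -3 * k)
    (by push_cast; linear_combination hk) (by push_cast; ring) c2 hs
  have c4 := fun s (hs : 0 < s) => covDeriv_baseCurve hb0 hg (x' := -30) (y' := 24 * k)
    (by push_cast; linear_combination 3 * hk) (by push_cast; ring) c3 hs
  have c5 := fun s (hs : 0 < s) => covDeriv_baseCurve hb0 hg (x' := 0) (y' := -126 * k)
    (by push_cast; linear_combination -24 * hk) (by push_cast; ring) c4 hs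
  refine ⟨isOpen_Ioi, Set.ordConnected_Ioi, contDiff_baseCurve.contDiffOn,
    fun s hs => baseCurve_mem hs, fun s hs => ?_, fun s hs => ?_⟩
  · rw [deriv_baseCurve, dirS_eq, metricNorm_baseCurve hg hs]
    simp
  · have hs' : s ≠ 0 := ne_of_gt hs
    have e1 : covDerivTangent g (baseCurve m) 1 s = _ := c1 s hs
    have e2 : covDerivTangent g (baseCurve m) 2 s = _ := c2 s hs
    have e3 : covDerivTangent g (baseCurve m) 3 s = _ := c3 s hs
    have e5 : covDerivTangent g (baseCurve m) 5 s = _ := c5 s hs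
    have e0 : deriv (baseCurve m) s = dirS m := deriv_baseCurve s
    have r1 := curvatureTensor_baseCurve (m := m) hb0 hg hs (15 / s ^ 3) (-3 * k / s ^ 3) 1 0
    have r2 := curvatureTensor_baseCurve (m := m) hb0 hg hs (-5 / s ^ 2) (-k / s ^ 2)
      (0 / s ^ 1) (k / s ^ 1)
    have hr : covDerivTangent g (baseCurve m) 5 s
        + Sum.elim ![0, -(b / s) ^ 2 * (-3 * k / s ^ 3 * 1 - 15 / s ^ 3 * 0)] 0
        - Sum.elim ![0, -(b / s) ^ 2 * (-k / s ^ 2 * (0 / s ^ 1) - -5 / s ^ 2 * (k / s ^ 1))] 0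
        = 0 := by
      rw [e5]
      funext l
      rcases l with l | l
      · fin_cases l
        · simp
        · simp
          field_simp
          linear_combination 8 * k * hb
      · simp
    rw [← r1, ← r2] at hr
    rw [e3, e2, e1, e0]
    exact hr

lemma curveCurvature_baseCurve (hb : b ≠ 0)
    (hg : ∀ p ∈ productDomain surfaceDomain m, g p = stripMetric (coneCoeff k b) m p)
    (hs : 0 < s) : curveCurvature g (baseCurve m) s = |k| / s := by
  have hT := fun s (_ : 0 < s) => deriv_baseCurve_eq (m := m) s
  have e1 : covDerivTangent g (baseCurve m) 1 s = _ :=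
    covDeriv_baseCurve hb hg (x' := 0) (y' := k) (by simp) (by simp) hT hs
  rw [curveCurvature, e1, metricNorm_baseCurve hg hs]
  simp [Real.sqrt_sq_eq_abs, abs_div, abs_of_pos hs]

end BaseCurve

/-- The metric of `S × ℝ^m` in the coordinates `(s, t, y)`. -/
lemma productMetric_ruledSurface {α : ℝ → E3} (hα : IsGeneratingCurve α) (m : ℕ) :
    ∀ p ∈ productDomain surfaceDomain m,
      productMetric (inducedMetric (ruledSurface α)) m p
        = stripMetric (coneCoeff (Real.sqrt 5) (3 * Real.sqrt 7 / 2)) m p := by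
  intro p hp
  have hp' : 0 < p (Sum.inl 0) := hp
  have h := inducedMetric_ruledSurface hα.smooth hα.unitSpeed (spaceCurvature_ne_zero hα)
    (p := p ∘ Sum.inl) hp
  rw [productMetric, h, stripMetric]
  have hτ : 3 * Real.sqrt 7 / (2 * p (Sum.inl 0)) = 3 * Real.sqrt 7 / 2 / p (Sum.inl 0) :=
    (div_div _ _ _).symm
  simp only [Function.comp_apply, hα.curvature _ hp', hα.torsion _ hp', hτ]
  rw [← Matrix.diagonal_one, Matrix.fromBlocks_diagonal]
  rfl

end TriharmonicCurves

end

theorem theorem1p1 :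
    -- up to rigid motions there is exactly one curve with the given curvature and torsion
    (∃ α : ℝ → TriharmonicCurves.E3, TriharmonicCurves.IsGeneratingCurve α) ∧
    (∀ α β : ℝ → TriharmonicCurves.E3,
      TriharmonicCurves.IsGeneratingCurve α → TriharmonicCurves.IsGeneratingCurve β →
        TriharmonicCurves.RigidlyCongruent α β) ∧
    ∀ α : ℝ → TriharmonicCurves.E3, TriharmonicCurves.IsGeneratingCurve α →
      -- `S` is an immersed surface
      TriharmonicCurves.IsImmersedSurface TriharmonicCurves.surfaceDomain
        (TriharmonicCurves.ruledSurface α) ∧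
      ∀ n : ℕ, 1 < n →
        -- `S × ℝ^(n-2)` is a Riemannian manifold
        TriharmonicCurves.IsRiemannianMetric
          (TriharmonicCurves.productDomain TriharmonicCurves.surfaceDomain (n - 2))
          (TriharmonicCurves.productMetric
            (TriharmonicCurves.inducedMetric (TriharmonicCurves.ruledSurface α)) (n - 2)) ∧
        -- `s ↦ (α(s), 0)` is triharmonic in it, with nonconstant curvature
        TriharmonicCurves.IsTriharmonicCurve
          (TriharmonicCurves.productDomain TriharmonicCurves.surfaceDomain (n - 2))
          (TriharmonicCurves.productMetric
            (TriharmonicCurves.inducedMetric (TriharmonicCurves.ruledSurface α)) (n - 2))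
          (Set.Ioi 0) (TriharmonicCurves.baseCurve (n - 2)) ∧
        ¬ ∃ c : ℝ, ∀ s ∈ Set.Ioi (0 : ℝ),
          TriharmonicCurves.curveCurvature
            (TriharmonicCurves.productMetric
              (TriharmonicCurves.inducedMetric (TriharmonicCurves.ruledSurface α)) (n - 2))
            (TriharmonicCurves.baseCurve (n - 2)) s = c := by
  refine ⟨TriharmonicCurves.exists_isGeneratingCurve,
    fun α β hα hβ => TriharmonicCurves.rigidlyCongruent_of_isGeneratingCurve hα hβ,
    fun α hα => ⟨?_, fun n _ => ?_⟩⟩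
  · refine TriharmonicCurves.isImmersedSurface_ruledSurface hα.smooth hα.unitSpeed
      (TriharmonicCurves.spaceCurvature_ne_zero hα) fun s hs => ?_
    have hs' : (0 : ℝ) < s := hs
    rw [hα.torsion s hs]
    positivity
  · have hg := TriharmonicCurves.productMetric_ruledSurface hα (n - 2)
    have hk : Real.sqrt 5 ^ 2 = 5 := Real.sq_sqrt (by norm_num)
    have hb : (3 * Real.sqrt 7 / 2) ^ 2 = 63 / 4 := by
      rw [div_pow, mul_pow, Real.sq_sqrt (by norm_num)]
      norm_num
    have hb0 : 3 * Real.sqrt 7 / 2 ≠ 0 := by positivity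
    refine ⟨TriharmonicCurves.isRiemannianMetric_of_eq_stripMetric hb0 hg,
      TriharmonicCurves.isTriharmonicCurve_baseCurve hk hb hg, ?_⟩
    rintro ⟨c, hc⟩
    -- the curvature is `√5 / s`, which differs at `s = 1` and `s = 2`
    have h1 := hc 1 (Set.mem_Ioi.mpr one_pos)
    have h2 := hc 2 (Set.mem_Ioi.mpr two_pos)
    rw [TriharmonicCurves.curveCurvature_baseCurve hb0 hg one_pos] at h1
    rw [TriharmonicCurves.curveCurvature_baseCurve hb0 hg two_pos] at h2
    have h5 : 0 < |Real.sqrt 5| := by positivity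
    linarith
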